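/- **Setting.** Let $\mathcal L$ be a real vector space with an inner product $Q$, whose elements are called linear forms (for example $\mathcal L=(\mathbb R^n)^*$ with the inner product dual to an inner product on $\mathbb R^n$, or the direct limit $\varinjlim_n(\mathbb R^n)^*$ for compatible inner products $Q_n$). A linear form $L$ is viewed as the function $z\mapsto z(L)$ on the space of points $\mathrm{Hom}_{\mathbb R}(\mathcal L,\mathbb C)$ (which is $\mathbb R^n\otimes\mathbb C$ if $\mathcal L=(\mathbb R^n)^*$), equipped with the topology of pointwise convergence. Let $\mathcal M_+$ be the algebra of holomorphic germs at $0$ on this space depending on finitely many linear forms, that is, germs of functions $g(L_1,\dots,L_k)$ with $L_i\in\mathcal L$ and $g$ holomorphic near $0$ in $\mathbb C^k$. Let $\mathcal M$ be the algebra of meromorphic germs at $0$ with linear poles, that is, fractions $h/(L_1\cdots L_n)$ with $h\in\mathcal M_+$ and $L_1,\dots,L_n\in\mathcal L\setminus\{0\}$. Let $\mathcal M_-\subset\mathcal M$ be the linear span of the polar germs, that is, the fractions $h(\ell_1,\dots,\ell_k)/(L_1\cdots L_n)$ with $n\ge 1$, $h$ holomorphic near $0$ in $\mathbb C^k$, $\ell_i\in\mathcal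 L$, $L_j\in\mathcal L\setminus\{0\}$ and $Q(\ell_i,L_j)=0$ for all $i,j$. **Theorem 5.1.** One has $\mathcal M=\mathcal M_+\oplus\mathcal M_-$. Let $\pi_+:\mathcal M\to\mathcal M_+$ be the projection onto $\mathcal M_+$ along $\mathcal M_-$, and let $\mathrm{ev}_0:\mathcal M_+\to\mathbb C$ be the evaluation at $0$. Let $W$ be a finite set, $V\subseteq W$, and let $g=g(z_w,\,w\in W)$ be a holomorphic germ at $0$ in $\mathbb C^W$. (i) Assume $V\neq\emptyset$. For every linearly independent family $(L_w)_{w\in W}$ of linear forms, there are holomorphic germs $f_v=f_v(z_w,\,w\in W)$, $v\in V$, at $0$ in $\mathbb C^W$ such that $$\pi_+\left(\frac{g(L_w,\,w\in W)}{\prod_{v\in V}L_v}\right)=\sum_{v\in V}\pi_+\left(\frac{f_v(L_w,\,w\in W)}{\prod_{u\in V\setminus\{v\}}L_u}\right).$$ (ii) If $(L_{1w})_{w\in W}$ and $(L_{2w})_{w\in W}$ are linearly independent families of linear forms and $c$ is a real constant such that $Q(L_{1v},L_{1w})=c\,Q(L_{2v},L_{2w})$ for all $v,w\in W$, then $$\mathrm{ev}_0\circ\pi_+\left(\frac{g(L_{1w},\,w\in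 W)}{\prod_{v\in V}L_{1v}}\right)=\mathrm{ev}_0\circ\pi_+\left(\frac{g(L_{2w},\,w\in W)}{\prod_{v\in V}L_{2v}}\right).$$ -/

import Mathlib

open Filter Topology

/-! Multivariate meromorphic germs at zero with linear poles.

Throughout, `E` is the real vector space of linear forms, with inner product `Q` given by
`inner ℝ`. For `E = (ℝⁿ)*` the space of points `E →ₗ[ℝ] ℂ` is `ℝⁿ ⊗ ℂ`. For the direct limit
`E` of the spaces `(ℝⁿ)*`, it is the projective limit of the spaces `ℝⁿ ⊗ ℂ`, and the germs
defined below, which depend on finitely many linear forms, form the direct limit of the germs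
on the spaces `ℝⁿ ⊗ ℂ`. -/

namespace LinearPoles

noncomputable section

/-- The neighbourhoods of zero in the space of points `E →ₗ[ℝ] ℂ`, for the topology of pointwise
convergence (the usual topology of a finite-dimensional space when `E` has finite dimension). -/
def nhdsZero (E : Type*) [AddCommGroup E] [Module ℝ E] : Filter (E →ₗ[ℝ] ℂ) :=
  Filter.comap (fun z : E →ₗ[ℝ] ℂ => (z : E → ℂ)) (𝓝 0)

/-- The germ at zero of the function `g (L_w, w ∈ W)`, that is `z ↦ g (L_w(z), w ∈ W)`. -/
def substGerm {E : Type*} [AddCommGroup E] [Module ℝ E] {W : Type*}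
    (g : (W → ℂ) → ℂ) (L : W → E) : Germ (nhdsZero E) ℂ :=
  ((fun z : E →ₗ[ℝ] ℂ => g (fun w => z (L w))) : (E →ₗ[ℝ] ℂ) → ℂ)

/-- A germ is holomorphic if it is of the form `g (L_1, …, L_k)` with `L_1, …, L_k` linear forms
and `g` holomorphic near zero in `ℂ^k`. -/
def IsHol {E : Type*} [AddCommGroup E] [Module ℝ E] (φ : Germ (nhdsZero E) ℂ) : Prop :=
  ∃ (k : ℕ) (L : Fin k → E) (g : (Fin k → ℂ) → ℂ), AnalyticAt ℂ g 0 ∧ φ = substGerm g L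

theorem isHol_substGerm {E : Type*} [AddCommGroup E] [Module ℝ E] {W : Type*} [Fintype W]
    (g : (W → ℂ) → ℂ) (hg : AnalyticAt ℂ g 0) (L : W → E) : IsHol (substGerm g L) := by
  let e := Fintype.equivFin W
  refine ⟨Fintype.card W, L ∘ e.symm, fun y => g (fun w => y (e w)), ?_, ?_⟩
  · have h : AnalyticAt ℂ (fun (y : Fin (Fintype.card W) → ℂ) (w : W) => y (e w)) 0 :=
      (ContinuousLinearMap.pi fun w =>
        (ContinuousLinearMap.proj (R := ℂ) (φ := fun _ : Fin (Fintype.card W) => ℂ)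
          (e w))).analyticAt 0
    exact AnalyticAt.fun_comp_of_eq (g := g) hg h rfl
  · simp [substGerm]

theorem IsHol.map₂ {E : Type*} [AddCommGroup E] [Module ℝ E] {φ ψ : Germ (nhdsZero E) ℂ}
    (hφ : IsHol φ) (hψ : IsHol ψ) (F : ℂ → ℂ → ℂ)
    (hF : ∀ {X : Type} [NormedAddCommGroup X] [NormedSpace ℂ X] (a b : X → ℂ) (x : X),
      AnalyticAt ℂ a x → AnalyticAt ℂ b x → AnalyticAt ℂ (fun y => F (a y) (b y)) x) :
    IsHol (Germ.map₂ F φ ψ) := by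
  obtain ⟨k, L, g, hg, rfl⟩ := hφ
  obtain ⟨m, M, h, hh, rfl⟩ := hψ
  have := isHol_substGerm (W := Fin k ⊕ Fin m)
    (fun y => F (g (fun i => y (.inl i))) (h (fun j => y (.inr j)))) (by
      apply hF
      · have hl : AnalyticAt ℂ (fun (y : Fin k ⊕ Fin m → ℂ) (i : Fin k) => y (.inl i)) 0 :=
          (ContinuousLinearMap.pi fun i => (ContinuousLinearMap.proj (R := ℂ)
            (φ := fun _ : Fin k ⊕ Fin m => ℂ) (.inl i))).analyticAt 0
        exact AnalyticAt.fun_comp_of_eq (g := g) hg hl rfl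
      · have hl : AnalyticAt ℂ (fun (y : Fin k ⊕ Fin m → ℂ) (i : Fin m) => y (.inr i)) 0 :=
          (ContinuousLinearMap.pi fun i => (ContinuousLinearMap.proj (R := ℂ)
            (φ := fun _ : Fin k ⊕ Fin m => ℂ) (.inr i))).analyticAt 0
        exact AnalyticAt.fun_comp_of_eq (g := h) hh hl rfl) (Sum.elim L M)
  exact this

/-- The algebra `𝓜₊` of holomorphic germs at zero. -/
def holGerms (E : Type*) [AddCommGroup E] [Module ℝ E] : Subring (Germ (nhdsZero E) ℂ) where
  carrier := {φ | IsHol φ}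
  mul_mem' := fun h₁ h₂ => h₁.map₂ h₂ (· * ·) fun _ _ _ ha hb => ha.mul hb
  one_mem' := isHol_substGerm (W := Fin 0) (fun _ => 1) analyticAt_const 0
  add_mem' := fun h₁ h₂ => h₁.map₂ h₂ (· + ·) fun _ _ _ ha hb => ha.add hb
  zero_mem' := isHol_substGerm (W := Fin 0) (fun _ => 0) analyticAt_const 0
  neg_mem' := fun {x} h₁ => by
    have := h₁.map₂ h₁ (fun a _ => -a) fun _ _ _ ha _ => ha.neg
    obtain ⟨k, L, g, hg, rfl⟩ := h₁
    exact this

/-- The holomorphic germ `g (L_w, w ∈ W)`. -/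
def subst {E : Type*} [AddCommGroup E] [Module ℝ E] {W : Type*} [Fintype W]
    (g : (W → ℂ) → ℂ) (hg : AnalyticAt ℂ g 0) (L : W → E) : holGerms E :=
  ⟨substGerm g L, isHol_substGerm g hg L⟩

/-- The evaluation at zero of a holomorphic germ. -/
def ev₀ {E : Type*} [AddCommGroup E] [Module ℝ E] (φ : holGerms E) : ℂ :=
  (φ : Germ (nhdsZero E) ℂ).liftOn (fun f => f 0) fun _ _ h =>
    (Filter.mem_comap.1 h).elim fun _ ht =>
      ht.2 (Set.mem_preimage.2 (mem_of_mem_nhds ht.1))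

/-- The linear form `L`, as a holomorphic germ. -/
def linForm {E : Type*} [AddCommGroup E] [Module ℝ E] (L : E) : holGerms E :=
  subst (fun y : Fin 1 → ℂ => y 0)
    ((ContinuousLinearMap.proj (R := ℂ) (φ := fun _ : Fin 1 => ℂ) 0).analyticAt 0) (fun _ => L)

/-- The multiplicative set generated by the nonzero linear forms (with real coefficients). -/
def linForms (E : Type*) [AddCommGroup E] [Module ℝ E] : Submonoid (holGerms E) :=
  Submonoid.closure {φ | ∃ L : E, L ≠ 0 ∧ φ = linForm L}

/-- The algebra `𝓜` of meromorphic germs at zero with linear poles: the fractions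
`h / (L_1 ⋯ L_n)` with `h` a holomorphic germ and `L_1, …, L_n` nonzero linear forms. -/
abbrev MeroGerm (E : Type*) [AddCommGroup E] [Module ℝ E] : Type _ :=
  Localization (linForms E)

/-- The meromorphic germ `1 / L`, for a linear form `L ≠ 0`. -/
def invForm {E : Type*} [AddCommGroup E] [Module ℝ E] (L : E) : MeroGerm E :=
  Ring.inverse (algebraMap (holGerms E) (MeroGerm E) (linForm L))

/-- The fraction `g (L_w, w ∈ W) / ∏_{v ∈ V} L_v`. -/
def frac {E : Type*} [AddCommGroup E] [Module ℝ E] {W : Type*} [Fintype W]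
    (g : (W → ℂ) → ℂ) (hg : AnalyticAt ℂ g 0) (L : W → E) (V : Finset W) : MeroGerm E :=
  algebraMap (holGerms E) (MeroGerm E) (subst g hg L) * ∏ v ∈ V, invForm (L v)

/-- A polar germ is a fraction `h (ℓ_1, …, ℓ_k) / (L_1 ⋯ L_n)` with `n ≥ 1`, where `h` is
holomorphic at zero, the linear forms `L_j` are nonzero and every `ℓ_i` is orthogonal to
every `L_j`. -/
def IsPolar {E : Type*} [NormedAddCommGroup E] [InnerProductSpace ℝ E] (f : MeroGerm E) : Prop :=
  ∃ (k : ℕ) (ℓ : Fin k → E) (h : (Fin k → ℂ) → ℂ) (hh : AnalyticAt ℂ h 0)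
    (n : ℕ) (L : Fin n → E), 1 ≤ n ∧ (∀ j, L j ≠ 0) ∧ (∀ i j, inner ℝ (ℓ i) (L j) = 0) ∧
      f = algebraMap (holGerms E) (MeroGerm E) (subst h hh ℓ) * ∏ j, invForm (L j)

/-- The space `𝓜₋` generated by the polar germs. The set of polar germs is stable under
multiplication by complex scalars, so the additive subgroup that it generates is its span. -/
def polarGerms (E : Type*) [NormedAddCommGroup E] [InnerProductSpace ℝ E] :
    AddSubgroup (MeroGerm E) :=
  AddSubgroup.closure {f | IsPolar f}

open Classical in
/-- The projection `π₊` of `𝓜 = 𝓜₊ ⊕ 𝓜₋` onto the holomorphic germs along `𝓜₋`: the value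
`π₊ f` is the holomorphic germ that differs from `f` by an element of `𝓜₋`. -/
def piPlus {E : Type*} [NormedAddCommGroup E] [InnerProductSpace ℝ E] (f : MeroGerm E) :
    holGerms E :=
  if h : ∃ p : holGerms E, f - algebraMap (holGerms E) (MeroGerm E) p ∈ polarGerms E then
    h.choose
  else 0

end

end LinearPoles

/-! The theorem rests on division with remainder by linear forms. Let `s` be a family of nonzero
forms. If the arguments of a holomorphic germ `φ` are projected orthogonally to the span of `s`, one
gets a germ `φ₀` with `φ = φ₀ + ∑ L q_L`, the sum being over `L ∈ s`, by Hadamard's lemma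
(`exists_analyticAt_divDiff`, `exists_subst_eq_add_sum`). For `s ≠ 0` the germ `φ₀ / ∏ s` is polar,
and the other terms have one pole less. This gives the existence in `𝓜 = 𝓜₊ ⊕ 𝓜₋` by induction
(`exists_sub_mem_polarGerms`), and also (i) and (ii) once `π₊` is known to be well defined: the
coefficients in the division are determined by those of orthogonal projections, which are the same
for two families whose Gram matrices are proportional (`exists_piPlus_frac_eq_sum`,
`ev₀_piPlus_frac_eq`).

The uniqueness is the harder part. The operators `Φ s : φ ↦ π₊ (φ / ∏ s)` on `𝓜₊` have to satisfy
`Φ 0 = id`, `Φ s (L φ) = Φ (s - L) φ` for `L ∈ s`, and, for `s ≠ 0`, `Φ s φ = 0` if `φ` depends only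
on forms orthogonal to `s`. By the division these conditions determine `Φ s` inductively
(`addMonoidHom_eq_zero`). Conversely such operators exist (`exists_isProjectionSystem`): for a basis
`b ⊆ s` of the span of `s`, Taylor expansion in one form of `b` after the other gives an operator
`Φ s` with the conditions for `L ∈ b` (`exists_addMonoidHom_of_compatible`), and the condition for
another `L ∈ s` follows from the uniqueness of `Φ (s - L)`. If now a holomorphic germ `p` is a sum
of polar germs, multiply by a common denominator `∏ s` and apply `Φ s`: the left side gives `p`,
and every polar germ gives zero. -/

open Filter Topology

namespace LinearPoles

noncomputable section

/-! ### Hadamard's lemma for holomorphic functions -/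

/-- The `n`-th term `∑ i, p (n + 1) (u, …, u, ·, v, …, v)`, with the free variable in position `i`,
of the power series in `(u, v)` of the divided difference of `∑ n, p n`. -/
def divDiffSeries {Y : Type*} [NormedAddCommGroup Y] [NormedSpace ℂ Y]
    (p : FormalMultilinearSeries ℂ Y ℂ) : FormalMultilinearSeries ℂ (Y × Y) (Y →L[ℂ] ℂ) :=
  fun n => ∑ i : Fin (n + 1),
    (ContinuousLinearMap.flipMultilinear ((p (n + 1)).curryMid i)).compContinuousLinearMap
      fun k : Fin n => if k.castSucc < i then ContinuousLinearMap.fst ℂ Y Y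
        else ContinuousLinearMap.snd ℂ Y Y

theorem divDiffSeries_apply {Y : Type*} [NormedAddCommGroup Y] [NormedSpace ℂ Y]
    (p : FormalMultilinearSeries ℂ Y ℂ) (n : ℕ) (m : Fin n → Y × Y) (x : Y) :
    divDiffSeries p n m x = ∑ i : Fin (n + 1),
      p (n + 1) (i.insertNth x fun k : Fin n => if k.castSucc < i then (m k).1 else (m k).2) := by
  simp only [divDiffSeries, sum_apply]
  refine Finset.sum_congr rfl fun i _ => ?_
  have : (fun k : Fin n => (if k.castSucc < i then ContinuousLinearMap.fst ℂ Y Y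
      else ContinuousLinearMap.snd ℂ Y Y) (m k)) =
      fun k : Fin n => if k.castSucc < i then (m k).1 else (m k).2 := by
    funext k
    split_ifs <;> rfl
  simp [this]

theorem norm_divDiffSeries_le {Y : Type*} [NormedAddCommGroup Y] [NormedSpace ℂ Y]
    (p : FormalMultilinearSeries ℂ Y ℂ) (n : ℕ) :
    ‖divDiffSeries p n‖ ≤ (n + 1) * ‖p (n + 1)‖ := by
  refine ContinuousMultilinearMap.opNorm_le_bound (by positivity) fun m => ?_
  refine ContinuousLinearMap.opNorm_le_bound _ (by positivity) fun x => ?_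
  rw [divDiffSeries_apply]
  refine (norm_sum_le _ _).trans ?_
  have key : ∀ i ∈ (Finset.univ : Finset (Fin (n + 1))),
      ‖p (n + 1) (i.insertNth x fun k : Fin n => if k.castSucc < i then (m k).1 else (m k).2)‖ ≤
        ‖p (n + 1)‖ * (∏ k, ‖m k‖) * ‖x‖ := by
    intro i _
    refine ((p (n + 1)).le_opNorm _).trans ?_
    rw [Fin.prod_univ_succAbove _ i, mul_assoc, mul_comm (∏ k, ‖m k‖)]
    simp only [Fin.insertNth_apply_same, Fin.insertNth_apply_succAbove]
    gcongr with k
    split_ifs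
    · exact norm_fst_le _
    · exact norm_snd_le _
  refine (Finset.sum_le_card_nsmul _ _ _ key).trans (le_of_eq ?_)
  simp
  ring

/-- A telescoping sum. -/
theorem divDiffSeries_apply_sub {Y : Type*} [NormedAddCommGroup Y] [NormedSpace ℂ Y]
    (p : FormalMultilinearSeries ℂ Y ℂ) (n : ℕ) (u v : Y) :
    divDiffSeries p n (fun _ => (u, v)) (u - v) =
      p (n + 1) (fun _ => u) - p (n + 1) (fun _ => v) := by
  let c : ℕ → ℂ := fun j => p (n + 1) fun k => if k.val < j then u else v
  have hc : ∀ i : Fin (n + 1), p (n + 1) (i.insertNth (u - v) fun k : Fin n =>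
      if k.castSucc < i then u else v) = c (i + 1) - c i := by
    intro i
    have h : ∀ (x : Y) (j : ℕ), (∀ k : Fin n, (i.succAbove k).val < j ↔ k.castSucc < i) →
        x = (if i.val < j then u else v) →
        (fun k : Fin (n + 1) => if k.val < j then u else v) =
          i.insertNth (α := fun _ => Y) x fun k : Fin n => if k.castSucc < i then u else v := by
      intro x j hk hx
      funext k
      refine Fin.succAboveCases i ?_ (fun k => ?_) k
      · simp [hx]
      · simp [hk]
    simp only [c]
    rw [h u (i + 1) _ (by simp), h v i _ (by simp)]
    · set f : Fin n → Y := fun k => if k.castSucc < i then u else v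
      have e : ∀ x : Y, i.insertNth (α := fun _ => Y) x f =
          Function.update (i.insertNth (α := fun _ => Y) v f) i x := fun x =>
        (Fin.update_insertNth (α := fun _ => Y) i v x f).symm
      rw [e (u - v), e u, ContinuousMultilinearMap.map_update_sub, ← e u, ← e v]
    · intro k
      rcases lt_or_ge k.castSucc i with hk | hk
      · have hk' : k.val < i.val := hk
        rw [Fin.succAbove_of_castSucc_lt _ _ hk, Fin.lt_def, Fin.val_castSucc]
      · have hk' : i.val ≤ k.val := hk
        rw [Fin.succAbove_of_le_castSucc _ _ hk, Fin.lt_def, Fin.val_castSucc, Fin.val_succ]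
        omega
    · intro k
      rcases lt_or_ge k.castSucc i with hk | hk
      · have hk' : k.val < i.val := hk
        rw [Fin.succAbove_of_castSucc_lt _ _ hk, Fin.lt_def, Fin.val_castSucc]
        omega
      · have hk' : i.val ≤ k.val := hk
        rw [Fin.succAbove_of_le_castSucc _ _ hk, Fin.lt_def, Fin.val_castSucc, Fin.val_succ]
        omega
  rw [divDiffSeries_apply]
  simp only [hc]
  rw [Fin.sum_univ_eq_sum_range (fun j => c (j + 1) - c j), Finset.sum_range_sub]
  have hle : ∀ k : Fin (n + 1), k.val ≤ n := Fin.is_le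
  simp [c, hle]

theorem divDiffSeries_radius_pos {Y : Type*} [NormedAddCommGroup Y] [NormedSpace ℂ Y]
    (p : FormalMultilinearSeries ℂ Y ℂ) (hp : 0 < p.radius) : 0 < (divDiffSeries p).radius := by
  obtain ⟨r, hr0, hr⟩ := ENNReal.lt_iff_exists_nnreal_btwn.1 hp
  have hr0' : 0 < (r : ℝ) := by exact_mod_cast hr0
  obtain ⟨C, -, hC⟩ := p.norm_mul_pow_le_of_lt_radius hr
  have : ((r / 2 : NNReal) : ENNReal) ≤ (divDiffSeries p).radius := by
    refine FormalMultilinearSeries.le_radius_of_bound _ (C / r) fun n => ?_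
    have h1 := norm_divDiffSeries_le p n
    have h2 : ((n : ℝ) + 1) ≤ 2 ^ n := by exact_mod_cast Nat.lt_two_pow_self (n := n)
    calc ‖divDiffSeries p n‖ * ((r / 2 : NNReal) : ℝ) ^ n
        ≤ (2 ^ n * ‖p (n + 1)‖) * ((r / 2 : NNReal) : ℝ) ^ n := by
          gcongr
          exact h1.trans (by gcongr)
      _ = ‖p (n + 1)‖ * r ^ (n + 1) / r := by
          push_cast
          rw [div_pow]
          field_simp
          ring
      _ ≤ C / r := by
          gcongr
          exact hC (n + 1)
  refine lt_of_lt_of_le ?_ this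
  have : 0 < r / 2 := by
    have : 0 < r := by exact_mod_cast hr0'
    positivity
  exact_mod_cast this

/-- Hadamard's lemma for germs of holomorphic functions: the difference `g u - g v` is
`G (u, v) (u - v)` with `G` holomorphic. -/
theorem exists_analyticAt_divDiff {Y : Type*} [NormedAddCommGroup Y] [NormedSpace ℂ Y]
    {g : Y → ℂ} (hg : AnalyticAt ℂ g 0) :
    ∃ G : Y × Y → Y →L[ℂ] ℂ, AnalyticAt ℂ G 0 ∧
      ∀ᶠ x : Y × Y in 𝓝 0, g x.1 - g x.2 = G x (x.1 - x.2) := by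
  obtain ⟨p, r, hp⟩ := hg
  have hq := (divDiffSeries p).hasFPowerSeriesOnBall
    (divDiffSeries_radius_pos p (hp.r_pos.trans_le hp.r_le))
  refine ⟨(divDiffSeries p).sum, hq.analyticAt, ?_⟩
  have h1 : ∀ᶠ x : Y × Y in 𝓝 0, x.1 ∈ Metric.eball (0 : Y) r :=
    continuousAt_fst.preimage_mem_nhds (Metric.eball_mem_nhds _ hp.r_pos)
  have h2 : ∀ᶠ x : Y × Y in 𝓝 0, x.2 ∈ Metric.eball (0 : Y) r :=
    continuousAt_snd.preimage_mem_nhds (Metric.eball_mem_nhds _ hp.r_pos)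
  filter_upwards [h1, h2, Metric.eball_mem_nhds (0 : Y × Y) hq.r_pos] with x hx1 hx2 hx
  have s1 := (hasSum_nat_add_iff' 1).2 (hp.hasSum hx1)
  have s2 := (hasSum_nat_add_iff' 1).2 (hp.hasSum hx2)
  have s3 := (ContinuousLinearMap.apply ℂ ℂ (x.1 - x.2)).hasSum (hq.hasSum hx)
  have s4 := s1.sub s2
  simp only [zero_add, ContinuousLinearMap.apply_apply] at s1 s2 s3 s4
  have s5 : (fun n => divDiffSeries p n (fun _ => x) (x.1 - x.2)) =
      fun n => p (n + 1) (fun _ => x.1) - p (n + 1) (fun _ => x.2) := by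
    funext n
    exact divDiffSeries_apply_sub p n x.1 x.2
  have s6 := s3.unique (s5 ▸ s4)
  rw [s6]
  have : p 0 (fun _ => x.1) = p 0 (fun _ => x.2) := congrArg _ (Subsingleton.elim _ _)
  simp [this]

/-- Hadamard's lemma for two linear substitutions whose difference is `∑ j, x j • a j`: then
`g ∘ A - g ∘ B` is a combination of the functionals `x j` near zero. -/
theorem exists_hadamard {X Y : Type*} [NormedAddCommGroup X] [NormedSpace ℂ X]
    [NormedAddCommGroup Y] [NormedSpace ℂ Y] {J : Type*} (V : Finset J) {g : Y → ℂ}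
    (hg : AnalyticAt ℂ g 0) (A B : X →L[ℂ] Y) (x : J → X →L[ℂ] ℂ) (a : J → Y)
    (h : ∀ z, A z - B z = ∑ j ∈ V, x j z • a j) :
    ∃ f : J → X → ℂ, (∀ j, AnalyticAt ℂ (f j) 0) ∧
      ∀ᶠ z in 𝓝 0, g (A z) = g (B z) + ∑ j ∈ V, x j z * f j z := by
  obtain ⟨G, hG, hGe⟩ := exists_analyticAt_divDiff hg
  have hAB : Tendsto (A.prod B) (𝓝 0) (𝓝 0) :=
    (A.prod B).continuous.tendsto' 0 0 (map_zero _)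
  refine ⟨fun j z => G (A.prod B z) (a j), fun j => ?_, ?_⟩
  · have h1 : AnalyticAt ℂ (fun z => G (A.prod B z)) 0 :=
      AnalyticAt.fun_comp_of_eq (g := G) hG ((A.prod B).analyticAt 0) (map_zero _)
    exact ((ContinuousLinearMap.apply ℂ ℂ (a j)).analyticAt _).comp h1
  · filter_upwards [hAB.eventually hGe] with z hz
    simp only [ContinuousLinearMap.prod_apply] at hz ⊢
    rw [h, map_sum] at hz
    simp only [map_smul, smul_eq_mul] at hz
    rw [← hz]
    ring

/-! ### Holomorphic germs and substitution of linear forms -/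

variable {E : Type*}

section module
variable [AddCommGroup E] [Module ℝ E]

theorem tendsto_eval {W : Type*} (L : W → E) :
    Tendsto (fun (z : E →ₗ[ℝ] ℂ) w => z (L w)) (nhdsZero E) (𝓝 0) := by
  have h : Tendsto (fun z : E →ₗ[ℝ] ℂ => (z : E → ℂ)) (nhdsZero E) (𝓝 0) := tendsto_comap
  exact tendsto_pi_nhds.2 fun w => tendsto_pi_nhds.1 h (L w)

theorem subst_congr {W W' : Type*} [Fintype W] [Fintype W'] {g : (W → ℂ) → ℂ}
    {g' : (W' → ℂ) → ℂ} (hg : AnalyticAt ℂ g 0) (hg' : AnalyticAt ℂ g' 0) (L : W → E) (L' : W' → E)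
    (h : ∀ᶠ z in nhdsZero E, g (fun w => z (L w)) = g' (fun w => z (L' w))) :
    subst g hg L = subst g' hg' L' :=
  Subtype.ext (Germ.coe_eq.2 h)

theorem exists_eq_subst (φ : holGerms E) : ∃ (k : ℕ) (L : Fin k → E) (g : (Fin k → ℂ) → ℂ)
    (hg : AnalyticAt ℂ g 0), φ = subst g hg L := by
  obtain ⟨k, L, g, hg, h⟩ := φ.2
  exact ⟨k, L, g, hg, Subtype.ext h⟩

/-- The constant holomorphic germ with real value `c`. -/
def constGerm (E : Type*) [AddCommGroup E] [Module ℝ E] (c : ℝ) : holGerms E :=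
  subst (fun _ : Fin 0 → ℂ => (c : ℂ)) analyticAt_const 0

/-- A linear form as a holomorphic germ, additively. -/
def linFormHom (E : Type*) [AddCommGroup E] [Module ℝ E] : E →+ holGerms E :=
  AddMonoidHom.mk' linForm fun L M => Subtype.ext <| Germ.coe_eq.2 <| .of_forall fun z =>
    map_add z L M

theorem linForm_smul (c : ℝ) (L : E) : linForm (c • L) = constGerm E c * linForm L :=
  Subtype.ext <| Germ.coe_eq.2 <| .of_forall fun z => by
    simp

theorem linForm_sum_smul {J : Type*} (V : Finset J) (c : J → ℝ) (L : J → E) :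
    linForm (∑ j ∈ V, c j • L j) = ∑ j ∈ V, constGerm E (c j) * linForm (L j) := by
  rw [show linForm (∑ j ∈ V, c j • L j) = linFormHom E (∑ j ∈ V, c j • L j) from rfl, map_sum]
  exact Finset.sum_congr rfl fun j _ => linForm_smul _ _

/-- Hadamard's lemma for `g (L_w, w ∈ W)`: subtracting combinations of the forms `L_v`, `v ∈ V`,
from the arguments changes the germ by a combination of the `L_v`. The coefficients `f v` depend
only on `g` and on the combinations, and not on the family `L`. -/
theorem exists_subst_eq_add_sum {W : Type*} [Fintype W] (V : Finset W) {g : (W → ℂ) → ℂ}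
    (hg : AnalyticAt ℂ g 0) (a : W → W → ℝ) :
    ∃ (f : W → (W → ℂ) → ℂ) (hf : ∀ v, AnalyticAt ℂ (f v) 0),
      ∀ {E : Type*} [AddCommGroup E] [Module ℝ E] (L : W → E),
        subst g hg L = subst g hg (fun w => L w - ∑ v ∈ V, a w v • L v) +
          ∑ v ∈ V, linForm (L v) * subst (f v) (hf v) L := by
  let B : (W → ℂ) →L[ℂ] W → ℂ := ContinuousLinearMap.pi fun w =>
    ContinuousLinearMap.proj (R := ℂ) (φ := fun _ : W => ℂ) w -
      ∑ v ∈ V, (a w v : ℂ) • ContinuousLinearMap.proj (R := ℂ) (φ := fun _ : W => ℂ) v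
  have hB : ∀ z w, B z w = z w - ∑ v ∈ V, a w v * z v := by
    intro z w
    simp [B]
  obtain ⟨f, hf, hfe⟩ := exists_hadamard V hg (ContinuousLinearMap.id ℂ (W → ℂ)) B
    (fun v => ContinuousLinearMap.proj (R := ℂ) (φ := fun _ : W => ℂ) v)
    (fun v w => (a w v : ℂ)) (by
      intro z
      ext w
      simp [hB, mul_comm])
  refine ⟨f, hf, fun {E} _ _ L => Subtype.ext ?_⟩
  have : (((subst g hg (fun w => L w - ∑ v ∈ V, a w v • L v) +
      ∑ v ∈ V, linForm (L v) * subst (f v) (hf v) L : holGerms E)) : Germ (nhdsZero E) ℂ) =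
      ((fun z : E →ₗ[ℝ] ℂ => g (fun w => z (L w - ∑ v ∈ V, a w v • L v)) +
        ∑ v ∈ V, z (L v) * f v (fun w => z (L w)) : (E →ₗ[ℝ] ℂ) → ℂ) :
          Germ (nhdsZero E) ℂ) := by
    have hs : ∀ S : Finset W, ((∑ v ∈ S, linForm (L v) * subst (f v) (hf v) L : holGerms E) :
        Germ (nhdsZero E) ℂ) = ((fun z : E →ₗ[ℝ] ℂ =>
          ∑ v ∈ S, z (L v) * f v (fun w => z (L w)) : (E →ₗ[ℝ] ℂ) → ℂ) :
            Germ (nhdsZero E) ℂ) := by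
      classical
      intro S
      induction S using Finset.induction_on with
      | empty => simp; rfl
      | insert v S hv ih =>
        simp only [Finset.sum_insert hv, Subring.coe_add, ih]
        rfl
    rw [Subring.coe_add, hs]
    rfl
  rw [this]
  refine Germ.coe_eq.2 ?_
  filter_upwards [(tendsto_eval L).eventually hfe] with z hz
  simp only [ContinuousLinearMap.id_apply, ContinuousLinearMap.proj_apply] at hz
  rw [hz]
  congr 2
  funext w
  rw [hB]
  simp

/-- Two substitutions in `g` that agree modulo the span of `b` give the same germ modulo the ideal
generated by `b`. -/
theorem exists_subst_sub_eq_sum {k : ℕ} {g : (Fin k → ℂ) → ℂ} (hg : AnalyticAt ℂ g 0)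
    (b : Finset E) (L L' : Fin k → E) (h : ∀ i, L i - L' i ∈ Submodule.span ℝ (b : Set E)) :
    ∃ q : E → holGerms E, subst g hg L = subst g hg L' + ∑ x ∈ b, linForm x * q x := by
  have h' : ∀ i, ∃ c : E → ℝ, ∑ x ∈ b, c x • x = L i - L' i := fun i => by
    obtain ⟨c, -, hc⟩ := Submodule.mem_span_finset.1 (h i)
    exact ⟨c, hc⟩
  choose c hc using h'
  let V : Finset (Fin k ⊕ b) := Finset.univ.map Function.Embedding.inr
  have hg' : AnalyticAt ℂ (fun y : Fin k ⊕ b → ℂ => g fun i => y (.inl i)) 0 :=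
    AnalyticAt.fun_comp_of_eq (g := g) hg ((ContinuousLinearMap.pi fun i =>
      ContinuousLinearMap.proj (R := ℂ) (φ := fun _ : Fin k ⊕ b => ℂ) (.inl i)).analyticAt 0) rfl
  obtain ⟨f, hf, hfe⟩ := exists_subst_eq_add_sum V hg'
    (Sum.elim (fun i => Sum.elim 0 fun x => c i x) fun _ => 0)
  have key := hfe (Sum.elim L fun x : b => (x : E))
  have e1 : subst _ hg' (Sum.elim L fun x : b => (x : E)) = subst g hg L := rfl
  have e2 : subst _ hg' (fun w => Sum.elim L (fun x : b => (x : E)) w - ∑ v ∈ V,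
      (Sum.elim (fun i => Sum.elim 0 fun x => c i x) (fun _ => 0) : Fin k ⊕ b → Fin k ⊕ b → ℝ) w v •
        Sum.elim L (fun x : b => (x : E)) v) = subst g hg L' := by
    refine subst_congr _ _ _ _ (.of_forall fun z => ?_)
    congr 1
    funext i
    simp only [V, Finset.sum_map, Function.Embedding.inr_apply, Sum.elim_inl, Sum.elim_inr,
      Finset.univ_eq_attach]
    rw [Finset.sum_attach b (fun x => c i x • x), hc, sub_sub_cancel]
  rw [e1, e2] at key
  classical
  refine ⟨fun x => if hx : x ∈ b then
    subst (f (.inr ⟨x, hx⟩)) (hf _) (Sum.elim L fun x : b => (x : E)) else 0, ?_⟩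
  rw [key, ← Finset.sum_attach b]
  simp [V]

/-- The holomorphic germs depending only on linear forms from the subspace `F`. -/
def holIn (F : Submodule ℝ E) : Set (holGerms E) :=
  {φ | ∃ (k : ℕ) (ℓ : Fin k → E) (g : (Fin k → ℂ) → ℂ) (hg : AnalyticAt ℂ g 0),
    (∀ i, ℓ i ∈ F) ∧ φ = subst g hg ℓ}

theorem holIn_mono {F F' : Submodule ℝ E} (h : F ≤ F') : holIn F ⊆ holIn F' := by
  rintro φ ⟨k, ℓ, g, hg, hℓ, rfl⟩
  exact ⟨k, ℓ, g, hg, fun i => h (hℓ i), rfl⟩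

theorem constGerm_mul_mem_holIn {F : Submodule ℝ E} (c : ℝ) {φ : holGerms E} (h : φ ∈ holIn F) :
    constGerm E c * φ ∈ holIn F := by
  obtain ⟨k, ℓ, g, hg, hℓ, rfl⟩ := h
  exact ⟨k, ℓ, fun y => (c : ℂ) * g y, analyticAt_const.mul hg, hℓ, rfl⟩

theorem linForm_mem_holIn {F : Submodule ℝ E} {L : E} (h : L ∈ F) : linForm L ∈ holIn F :=
  ⟨1, fun _ => L, _, _, fun _ => h, rfl⟩

/-- A nonzero linear form is not a zero divisor, since holomorphic germs have continuous
representatives and the form vanishes nowhere on a dense set. -/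
theorem linForm_mul_eq_zero {M : E} {e : E →ₗ[ℝ] ℝ} (he : e M = 1) {φ : holGerms E}
    (h : linForm M * φ = 0) : φ = 0 := by
  obtain ⟨k, L, g, hg, rfl⟩ := exists_eq_subst φ
  have h0 : ∀ᶠ z in nhdsZero E, z M * g (fun i => z (L i)) = 0 :=
    Germ.coe_eq.1 (congrArg Subtype.val h)
  obtain ⟨t, ht, hs⟩ := Filter.mem_comap.1 h0
  obtain ⟨U, hUt, hU, hU0⟩ := mem_nhds_iff.1 ht
  refine Subtype.ext (Germ.coe_eq.2 ?_)
  have hz1 : ∀ᶠ z : E →ₗ[ℝ] ℂ in nhdsZero E, (z : E → ℂ) ∈ U :=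
    Filter.mem_comap.2 ⟨U, hU.mem_nhds hU0, subset_rfl⟩
  filter_upwards [hz1, (tendsto_eval L).eventually hg.eventually_analyticAt] with z hzU hza
  change g (fun i => z (L i)) = 0
  -- approach `z` along the line in the direction of `e`, transversal to the zero set of `M`
  let γ : ℂ → E →ₗ[ℝ] ℂ := fun t => z + t • Complex.ofRealCLM.toLinearMap.comp e
  have hγ : ∀ t x, γ t x = z x + t * e x := fun t x => by simp [γ]
  have hγU : ∀ᶠ t in 𝓝[≠] (0 : ℂ), (γ t : E → ℂ) ∈ U := by
    have hc : Continuous fun t => (γ t : E → ℂ) := by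
      refine continuous_pi fun x => ?_
      simp only [hγ]
      fun_prop
    refine (hc.continuousAt.tendsto.mono_left nhdsWithin_le_nhds).eventually
      (hU.mem_nhds ?_)
    simpa [γ] using hzU
  have hlim : Tendsto (fun t => g (fun i => γ t (L i))) (𝓝[≠] 0) (𝓝 (g fun i => z (L i))) := by
    have hc : Continuous fun t => fun i => γ t (L i) := by
      refine continuous_pi fun x => ?_
      simp only [hγ]
      fun_prop
    have h1 : Tendsto (fun t => fun i => γ t (L i)) (𝓝[≠] 0) (𝓝 fun i => z (L i)) := by
      have := (hc.tendsto 0).mono_left (nhdsWithin_le_nhds (s := {0}ᶜ))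
      simpa [γ] using this
    exact hza.continuousAt.tendsto.comp h1
  by_cases hzM : z M = 0
  · refine tendsto_nhds_unique_of_eventuallyEq hlim tendsto_const_nhds ?_
    filter_upwards [hγU, self_mem_nhdsWithin] with t htU ht0
    have := hs (hUt htU)
    simp only [Set.mem_ofPred_eq, hγ t M, hzM, he, zero_add, Complex.ofReal_one, mul_one] at this
    exact (mul_eq_zero.1 this).resolve_left ht0
  · exact (mul_eq_zero.1 (hs (hUt hzU))).resolve_left hzM

theorem linForm_mul_cancel {M : E} {e : E →ₗ[ℝ] ℝ} (he : e M = 1) {φ ψ : holGerms E}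
    (h : linForm M * φ = linForm M * ψ) : φ = ψ :=
  sub_eq_zero.1 (linForm_mul_eq_zero he (by rw [mul_sub, h, sub_self]))

end module

section module
variable [AddCommGroup E] [Module ℝ E]

/-! ### Division by one linear form -/

/-- The projection `z ↦ z - z(M) e` of the space of points, which for `e M = 1` has image `M = 0`. -/
def killForm (M : E) (e : E →ₗ[ℝ] ℝ) (z : E →ₗ[ℝ] ℂ) : E →ₗ[ℝ] ℂ :=
  z - z M • Complex.ofRealCLM.toLinearMap.comp e

theorem killForm_apply (M : E) (e : E →ₗ[ℝ] ℝ) (z : E →ₗ[ℝ] ℂ) (L : E) :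
    killForm M e z L = z (L - e L • M) := by
  simp [killForm, mul_comm]

theorem tendsto_killForm (M : E) (e : E →ₗ[ℝ] ℝ) :
    Tendsto (killForm M e) (nhdsZero E) (nhdsZero E) := by
  refine tendsto_comap_iff.2 ?_
  have := tendsto_eval (fun L : E => L - e L • M)
  refine this.congr fun z => ?_
  funext L
  exact (killForm_apply M e z L).symm

/-- The pullback of holomorphic germs along `killForm M e`: the substitution
`L ↦ L - e(L) M`, that is, for `e M = 1`, the restriction to `M = 0`. -/
def restrictForm (M : E) (e : E →ₗ[ℝ] ℝ) : holGerms E →+* holGerms E where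
  toFun φ := ⟨(φ : Germ (nhdsZero E) ℂ).compTendsto (killForm M e) (tendsto_killForm M e), by
    obtain ⟨k, L, g, hg, rfl⟩ := exists_eq_subst φ
    refine ⟨k, fun i => L i - e (L i) • M, g, hg, Germ.coe_eq.2 (.of_forall fun z => ?_)⟩
    simp only [Function.comp_apply, killForm_apply]⟩
  map_one' := rfl
  map_zero' := rfl
  map_mul' φ ψ := by
    obtain ⟨φ, hφ⟩ := φ
    obtain ⟨ψ, hψ⟩ := ψ
    refine Subtype.ext ?_
    induction φ using Germ.inductionOn
    induction ψ using Germ.inductionOn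
    rfl
  map_add' φ ψ := by
    obtain ⟨φ, hφ⟩ := φ
    obtain ⟨ψ, hψ⟩ := ψ
    refine Subtype.ext ?_
    induction φ using Germ.inductionOn
    induction ψ using Germ.inductionOn
    rfl

theorem restrictForm_subst (M : E) (e : E →ₗ[ℝ] ℝ) {k : ℕ} {g : (Fin k → ℂ) → ℂ}
    (hg : AnalyticAt ℂ g 0) (L : Fin k → E) :
    restrictForm M e (subst g hg L) = subst g hg fun i => L i - e (L i) • M :=
  Subtype.ext <| Germ.coe_eq.2 <| .of_forall fun z => by
    simp only [Function.comp_apply, killForm_apply]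

theorem restrictForm_self {M : E} {e : E →ₗ[ℝ] ℝ} (he : e M = 1) :
    restrictForm M e (linForm M) = 0 := by
  refine (restrictForm_subst M e _ fun _ : Fin 1 => M).trans ?_
  refine Subtype.ext <| Germ.coe_eq.2 <| .of_forall fun z => ?_
  simp [he]

theorem restrictForm_of_mem {M : E} {e : E →ₗ[ℝ] ℝ} {φ : holGerms E}
    (h : φ ∈ holIn (LinearMap.ker e)) : restrictForm M e φ = φ := by
  obtain ⟨k, L, g, hg, hL, rfl⟩ := h
  rw [restrictForm_subst]
  congr 1
  funext i
  rw [LinearMap.mem_ker.1 (hL i), zero_smul, sub_zero]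

theorem exists_eq_restrictForm_add {M : E} {e : E →ₗ[ℝ] ℝ} (φ : holGerms E) :
    ∃ q, φ = restrictForm M e φ + linForm M * q := by
  obtain ⟨k, L, g, hg, rfl⟩ := exists_eq_subst φ
  obtain ⟨q, hq⟩ := exists_subst_sub_eq_sum hg {M} L (fun i => L i - e (L i) • M) fun i => by
    simpa using Submodule.smul_mem _ _ (Submodule.mem_span_singleton_self M)
  refine ⟨q M, ?_⟩
  rw [restrictForm_subst]
  simpa using hq

/-- The divided difference `(φ - φ|_{M = 0}) / M`. -/
def divForm {M : E} {e : E →ₗ[ℝ] ℝ} (he : e M = 1) : holGerms E →+ holGerms E :=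
  AddMonoidHom.mk' (fun φ => (exists_eq_restrictForm_add (M := M) (e := e) φ).choose) fun φ ψ => by
    refine linForm_mul_cancel he ?_
    have h := fun χ => (exists_eq_restrictForm_add (M := M) (e := e) χ).choose_spec
    linear_combination h φ + h ψ - h (φ + ψ) - map_add (restrictForm M e) φ ψ

theorem divForm_spec {M : E} {e : E →ₗ[ℝ] ℝ} (he : e M = 1) (φ : holGerms E) :
    φ = restrictForm M e φ + linForm M * divForm he φ :=
  (exists_eq_restrictForm_add φ).choose_spec

theorem divForm_self_mul {M : E} {e : E →ₗ[ℝ] ℝ} (he : e M = 1) (φ : holGerms E) :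
    divForm he (linForm M * φ) = φ := by
  refine linForm_mul_cancel he ?_
  have h := divForm_spec he (linForm M * φ)
  rw [map_mul, restrictForm_self he] at h
  linear_combination -h

theorem divForm_mul {M : E} {e : E →ₗ[ℝ] ℝ} (he : e M = 1) {L : E} (hL : e L = 0)
    (φ : holGerms E) : divForm he (linForm L * φ) = linForm L * divForm he φ := by
  refine linForm_mul_cancel he ?_
  have h := divForm_spec he (linForm L * φ)
  rw [map_mul, restrictForm_of_mem (linForm_mem_holIn (LinearMap.mem_ker.2 hL))] at h
  linear_combination linForm L * divForm_spec he φ - h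

theorem divForm_of_mem {M : E} {e : E →ₗ[ℝ] ℝ} (he : e M = 1) {φ : holGerms E}
    (h : φ ∈ holIn (LinearMap.ker e)) : divForm he φ = 0 := by
  refine linForm_mul_cancel he ?_
  have h1 := divForm_spec he φ
  rw [restrictForm_of_mem h] at h1
  linear_combination -h1

end module

section inner
variable [NormedAddCommGroup E] [InnerProductSpace ℝ E]

/-! ### Division by several linear forms and projection systems -/

/-- The inner product with the component of `M` orthogonal to `F`, normalized. -/
theorem exists_functional {F : Submodule ℝ E} [F.HasOrthogonalProjection] {M : E} (hM : M ∉ F) :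
    ∃ e : E →ₗ[ℝ] ℝ, e M = 1 ∧ (∀ x ∈ F, e x = 0) ∧ ∀ x ∈ (F ⊔ Submodule.span ℝ {M})ᗮ, e x = 0 := by
  set m : E := M - F.starProjection M
  have hmF : m ∈ Fᗮ := F.sub_starProjection_mem_orthogonal M
  have hpF : F.starProjection M ∈ F := F.starProjection_apply_mem M
  have hm : m ≠ 0 := fun h => hM (by rw [sub_eq_zero.1 h]; exact hpF)
  have hmM : inner ℝ m M ≠ 0 := by
    have : inner ℝ m M = inner ℝ m m := by
      rw [show inner ℝ m m = inner ℝ m (M - F.starProjection M) from rfl, inner_sub_right,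
        F.inner_left_of_mem_orthogonal hpF hmF, sub_zero]
    rw [this]
    exact inner_self_ne_zero.2 hm
  refine ⟨(inner ℝ m M)⁻¹ • innerₗ E m, by simp [hmM], fun x hx => ?_, fun x hx => ?_⟩
  · simp [F.inner_left_of_mem_orthogonal hx hmF]
  · have : m ∈ F ⊔ Submodule.span ℝ {M} :=
      Submodule.sub_mem _ (Submodule.mem_sup_right (Submodule.mem_span_singleton_self M))
        (Submodule.mem_sup_left hpF)
    simp [Submodule.inner_right_of_mem_orthogonal this hx]

/-- Modulo the ideal generated by finitely many forms, every holomorphic germ depends only on the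
forms orthogonal to them. -/
theorem exists_eq_add_sum_linForm_mul (b : Finset E) (φ : holGerms E) :
    ∃ φ₀ ∈ holIn (Submodule.span ℝ (b : Set E))ᗮ, ∃ q : E → holGerms E,
      φ = φ₀ + ∑ x ∈ b, linForm x * q x := by
  obtain ⟨k, L, g, hg, rfl⟩ := exists_eq_subst φ
  let F := Submodule.span ℝ (b : Set E)
  obtain ⟨q, hq⟩ := exists_subst_sub_eq_sum hg b L (fun i => L i - F.starProjection (L i))
    fun i => by
      rw [sub_sub_cancel]
      exact F.starProjection_apply_mem (L i)
  exact ⟨_, ⟨k, _, g, hg, fun i => F.sub_starProjection_mem_orthogonal (L i), rfl⟩, q, hq⟩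

/-- The uniqueness of the operators in a projection system. -/
theorem addMonoidHom_eq_zero {b : Finset E} {G : holGerms E →+ holGerms E}
    (h : ∀ x ∈ b, ∀ φ, G (linForm x * φ) = 0)
    (h0 : ∀ φ ∈ holIn (Submodule.span ℝ (b : Set E))ᗮ, G φ = 0) : G = 0 := by
  ext1 φ
  obtain ⟨φ₀, hφ₀, q, rfl⟩ := exists_eq_add_sum_linForm_mul b φ
  rw [map_add, h0 _ hφ₀, map_sum, Finset.sum_eq_zero fun x hx => h x hx _, zero_add,
    AddMonoidHom.zero_apply]

/-- Integration of a compatible system: operators `T x`, indexed by independent forms `x`, with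
`T x (y φ) = T y (x φ)` come from one operator. It is built from the Taylor expansions in one form
after the other. -/
theorem exists_addMonoidHom_of_compatible (b : Finset E) (hb : LinearIndepOn ℝ id (b : Set E))
    (T : E → holGerms E →+ holGerms E)
    (hT : ∀ x ∈ b, ∀ y ∈ b, ∀ φ, T x (linForm y * φ) = T y (linForm x * φ)) :
    ∃ S : holGerms E →+ holGerms E, (∀ x ∈ b, ∀ φ, S (linForm x * φ) = T x φ) ∧
      ∀ φ ∈ holIn (Submodule.span ℝ (b : Set E))ᗮ, S φ = 0 := by
  classical
  induction b using Finset.induction_on with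
  | empty => exact ⟨0, by simp, by simp⟩
  | insert M b hM ih =>
    rw [Finset.coe_insert] at hb
    have hb' := (linearIndepOn_id_insert (by simpa using hM)).1 hb
    obtain ⟨S, hS, hS0⟩ := ih hb'.1 fun x hx y hy =>
      hT x (Finset.mem_insert_of_mem hx) y (Finset.mem_insert_of_mem hy)
    obtain ⟨e, heM, heF, heo⟩ := exists_functional hb'.2
    have heb : ∀ x ∈ b, e x = 0 := fun x hx => heF x (Submodule.subset_span hx)
    refine ⟨(T M).comp (divForm heM) + S.comp (restrictForm M e).toAddMonoidHom, ?_, ?_⟩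
    · intro x hx φ
      rcases Finset.mem_insert.1 hx with rfl | hx'
      · simp [divForm_self_mul, restrictForm_self heM]
      · simp only [AddMonoidHom.add_apply, AddMonoidHom.comp_apply, divForm_mul heM (heb x hx'),
          RingHom.toAddMonoidHom_eq_coe, AddMonoidHom.coe_coe, map_mul,
          restrictForm_of_mem (linForm_mem_holIn (LinearMap.mem_ker.2 (heb x hx'))), hS x hx']
        rw [hT M (Finset.mem_insert_self _ _) x hx, ← map_add]
        conv_rhs => rw [divForm_spec heM φ]
        rw [add_comm]
    · intro φ hφ
      rw [Finset.coe_insert, Set.insert_eq, Submodule.span_union, sup_comm] at hφ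
      have h1 : φ ∈ holIn (LinearMap.ker e) := holIn_mono (fun x hx => heo x hx) hφ
      have h2 : φ ∈ holIn (Submodule.span ℝ (b : Set E))ᗮ :=
        holIn_mono (Submodule.orthogonal_le le_sup_left) hφ
      simp [divForm_of_mem heM h1, restrictForm_of_mem h1, hS0 φ h2]

open Classical in
/-- A system of operators `Φ s`, which send `φ` to what will be `π₊ (φ / ∏_{L ∈ s} L)`, for the
families `s` of at most `n` nonzero forms. The bound on the size of `s` makes an induction
possible. -/
def IsProjectionSystem (n : ℕ) (Φ : Multiset E → holGerms E →+ holGerms E) : Prop :=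
  Φ 0 = AddMonoidHom.id _ ∧ ∀ s : Multiset E, s.card ≤ n → 0 ∉ s →
    (∀ L ∈ s, ∀ φ, Φ s (linForm L * φ) = Φ (s.erase L) φ) ∧
    (s ≠ 0 → ∀ φ ∈ holIn (Submodule.span ℝ {x | x ∈ s})ᗮ, Φ s φ = 0)

open Classical in
/-- `Φ s` is integrated from the operators `Φ (s.erase x)`, for `x` in a basis of the span of `s`
contained in `s`. The compatibility with the other forms of `s` is a case of uniqueness. -/
theorem exists_isProjectionSystem (n : ℕ) :
    ∃ Φ : Multiset E → holGerms E →+ holGerms E, IsProjectionSystem n Φ := by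
  unfold IsProjectionSystem
  induction n with
  | zero =>
    refine ⟨fun _ => AddMonoidHom.id _, rfl, fun s hs _ => ?_⟩
    obtain rfl := Multiset.card_eq_zero.1 (Nat.le_zero.1 hs)
    simp
  | succ n ih =>
    obtain ⟨Φ, hΦ0, hΦ⟩ := ih
    have step : ∀ s : Multiset E, s.card = n + 1 → 0 ∉ s → ∃ S : holGerms E →+ holGerms E,
        (∀ L ∈ s, ∀ φ, S (linForm L * φ) = Φ (s.erase L) φ) ∧
        ∀ φ ∈ holIn (Submodule.span ℝ {x | x ∈ s})ᗮ, S φ = 0 := by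
      intro s hs hs0
      have hcard : ∀ L ∈ s, (s.erase L).card ≤ n := fun L hL => by
        rw [Multiset.card_erase_of_mem hL, hs]; simp
      have hne : ∀ L, 0 ∉ s.erase L := fun L h => hs0 (Multiset.mem_of_mem_erase h)
      have hcomm : ∀ L ∈ s, ∀ M ∈ s, ∀ φ,
          Φ (s.erase L) (linForm M * φ) = Φ (s.erase M) (linForm L * φ) := by
        intro L hL M hM φ
        rcases eq_or_ne L M with rfl | hLM
        · rfl
        · rw [(hΦ _ (hcard L hL) (hne L)).1 M ((Multiset.mem_erase_of_ne hLM.symm).2 hM),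
            (hΦ _ (hcard M hM) (hne M)).1 L ((Multiset.mem_erase_of_ne hLM).2 hL),
            Multiset.erase_comm]
      obtain ⟨b₀, hb₀, hspan, hind⟩ := exists_linearIndependent ℝ {x | x ∈ s}
      have hfin : b₀.Finite := s.toFinset.finite_toSet.subset fun x hx => by
        simpa using hb₀ hx
      obtain ⟨b, rfl⟩ := hfin.exists_finset_coe
      have hbs : ∀ x ∈ b, x ∈ s := fun x hx => hb₀ hx
      obtain ⟨S, hS, hS0⟩ := exists_addMonoidHom_of_compatible b hind (fun x => Φ (s.erase x))
        fun x hx y hy => hcomm x (hbs x hx) y (hbs y hy)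
      refine ⟨S, fun L hL φ => ?_, hspan ▸ hS0⟩
      by_cases hLb : L ∈ b
      · exact hS L hLb φ
      have hLspan : L ∈ Submodule.span ℝ (b : Set E) := hspan ▸ Submodule.subset_span hL
      obtain ⟨c, -, hc⟩ := Submodule.mem_span_finset.1 hLspan
      have hlin : linForm L = ∑ x ∈ b, constGerm E (c x) * linForm x := by
        rw [← hc, linForm_sum_smul]
      -- the difference of the two sides, which vanishes by uniqueness
      let G : holGerms E →+ holGerms E :=
        ∑ x ∈ b, (Φ (s.erase x)).comp (AddMonoidHom.mulLeft (constGerm E (c x))) - Φ (s.erase L)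
      have hGa : ∀ ψ, G ψ = ∑ x ∈ b, Φ (s.erase x) (constGerm E (c x) * ψ) - Φ (s.erase L) ψ := by
        intro ψ
        simp [G, AddMonoidHom.finsetSum_apply]
      have hG : G = 0 := by
        refine addMonoidHom_eq_zero (b := b) (fun y hy ψ => ?_) fun ψ hψ => ?_
        · have h1 : ∀ x ∈ b, Φ (s.erase x) (constGerm E (c x) * (linForm y * ψ)) =
              Φ (s.erase y) (constGerm E (c x) * linForm x * ψ) := by
            intro x hx
            rw [mul_left_comm, hcomm x (hbs x hx) y (hbs y hy)]
            congr 1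
            ring
          rw [hGa, Finset.sum_congr rfl h1, ← map_sum, ← Finset.sum_mul, ← hlin,
            hcomm y (hbs y hy) L hL, sub_self]
        · have hle : ∀ x, (Submodule.span ℝ (b : Set E))ᗮ ≤
              (Submodule.span ℝ {y | y ∈ s.erase x})ᗮ := fun x => by
            rw [hspan]
            exact Submodule.orthogonal_le (Submodule.span_mono fun y hy =>
              Multiset.mem_of_mem_erase hy)
          have h1 : ∀ x ∈ b, Φ (s.erase x) (constGerm E (c x) * ψ) = 0 := by
            intro x hx
            have hxL : L ≠ x := fun h => hLb (h ▸ hx)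
            refine (hΦ _ (hcard x (hbs x hx)) (hne x)).2 (fun h => ?_) _
              (constGerm_mul_mem_holIn _ (holIn_mono (hle x) hψ))
            have := (Multiset.mem_erase_of_ne hxL).2 hL
            simp [h] at this
          -- `b` is not empty, since its span contains `L ≠ 0`
          obtain ⟨y, hy⟩ : b.Nonempty := by
            rw [Finset.nonempty_iff_ne_empty]
            rintro rfl
            rw [Finset.sum_empty] at hc
            exact hs0 (hc ▸ hL)
          have hyL : y ≠ L := fun h => hLb (h ▸ hy)
          rw [hGa, Finset.sum_eq_zero h1, zero_sub, neg_eq_zero]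
          refine (hΦ _ (hcard L hL) (hne L)).2 (fun h => ?_) _ (holIn_mono (hle L) hψ)
          have := (Multiset.mem_erase_of_ne hyL).2 (hbs y hy)
          simp [h] at this
      have h2 := DFunLike.congr_fun hG φ
      rw [hGa, AddMonoidHom.zero_apply, sub_eq_zero] at h2
      rw [← h2, hlin, Finset.sum_mul, map_sum]
      refine Finset.sum_congr rfl fun x hx => ?_
      rw [mul_assoc, mul_left_comm, hS x hx]
    let Ψ : Multiset E → holGerms E →+ holGerms E := fun s =>
      if h : s.card = n + 1 ∧ 0 ∉ s then (step s h.1 h.2).choose else Φ s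
    have hΨ : ∀ s : Multiset E, s.card ≤ n → Ψ s = Φ s := fun s hs => by
      simp only [Ψ]
      rw [dif_neg]
      omega
    refine ⟨Ψ, by rw [hΨ 0 (by simp), hΦ0], fun s hs hs0 => ?_⟩
    rcases hs.lt_or_eq with hs' | hs'
    · have hs'' : s.card ≤ n := Nat.lt_succ_iff.1 hs'
      rw [hΨ s hs'']
      refine ⟨fun L hL φ => ?_, (hΦ s hs'' hs0).2⟩
      rw [hΨ _ ((Multiset.card_le_card (Multiset.erase_le L s)).trans hs'')]
      exact (hΦ s hs'' hs0).1 L hL φ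
    · have h1 : Ψ s = (step s hs' hs0).choose := dif_pos ⟨hs', hs0⟩
      have h2 := (step s hs' hs0).choose_spec
      rw [h1]
      refine ⟨fun L hL φ => ?_, fun _ => h2.2⟩
      rw [h2.1 L hL, hΨ]
      rw [Multiset.card_erase_of_mem hL, hs']
      simp

end inner

section module
variable [AddCommGroup E] [Module ℝ E]

/-! ### Fractions -/

/-- The product of the linear forms of a family, as a holomorphic germ. -/
def prodForm (s : Multiset E) : holGerms E := (s.map linForm).prod

/-- The meromorphic germ `∏_{L ∈ s} 1 / L`. -/
def invProd (s : Multiset E) : MeroGerm E := (s.map invForm).prod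

theorem prodForm_cons (L : E) (s : Multiset E) : prodForm (L ::ₘ s) = linForm L * prodForm s := by
  simp [prodForm]

theorem prodForm_add (s t : Multiset E) : prodForm (s + t) = prodForm s * prodForm t := by
  simp [prodForm]

theorem invProd_cons (L : E) (s : Multiset E) : invProd (L ::ₘ s) = invForm L * invProd s := by
  simp [invProd]

theorem algebraMap_linForm_mul_invForm {L : E} (hL : L ≠ 0) :
    algebraMap (holGerms E) (MeroGerm E) (linForm L) * invForm L = 1 :=
  Ring.mul_inverse_cancel _ <| IsLocalization.map_units (MeroGerm E)
    (⟨linForm L, Submonoid.subset_closure ⟨L, hL, rfl⟩⟩ : linForms E)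

theorem algebraMap_prodForm_mul_invProd {s : Multiset E} (hs : 0 ∉ s) :
    algebraMap (holGerms E) (MeroGerm E) (prodForm s) * invProd s = 1 := by
  induction s using Multiset.induction_on with
  | empty => simp [prodForm, invProd]
  | cons L s ih =>
    rw [Multiset.mem_cons, not_or] at hs
    rw [prodForm_cons, invProd_cons, map_mul, mul_mul_mul_comm,
      algebraMap_linForm_mul_invForm (Ne.symm hs.1), ih hs.2, one_mul]

theorem exists_eq_prodForm {y : holGerms E} (hy : y ∈ linForms E) :
    ∃ s : Multiset E, 0 ∉ s ∧ y = prodForm s := by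
  induction hy using Submonoid.closure_induction with
  | mem x hx =>
    obtain ⟨L, hL, rfl⟩ := hx
    exact ⟨{L}, by simpa using hL.symm, by simp [prodForm]⟩
  | one => exact ⟨0, by simp, by simp [prodForm]⟩
  | mul x y _ _ hx hy =>
    obtain ⟨s, hs, rfl⟩ := hx
    obtain ⟨t, ht, rfl⟩ := hy
    exact ⟨s + t, by simp [hs, ht], (prodForm_add s t).symm⟩

theorem exists_eq_mul_invProd (f : MeroGerm E) :
    ∃ (s : Multiset E) (φ : holGerms E), 0 ∉ s ∧
      f = algebraMap (holGerms E) (MeroGerm E) φ * invProd s := by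
  obtain ⟨⟨φ, y⟩, h⟩ := IsLocalization.surj (linForms E) f
  obtain ⟨s, hs, hy⟩ := exists_eq_prodForm y.2
  refine ⟨s, φ, hs, ?_⟩
  simp only [hy] at h
  rw [← h, mul_assoc, algebraMap_prodForm_mul_invProd hs, mul_one]

end module

section inner
variable [NormedAddCommGroup E] [InnerProductSpace ℝ E]

/-! ### Polar germs and the decomposition -/

theorem mem_orthogonal_span {s : Set E} {y : E} (h : ∀ x ∈ s, inner ℝ y x = 0) :
    y ∈ (Submodule.span ℝ s)ᗮ := by
  rw [Submodule.mem_orthogonal']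
  intro u hu
  induction hu using Submodule.span_induction with
  | mem x hx => exact h x hx
  | zero => simp
  | add x y _ _ hx hy => simp [inner_add_right, hx, hy]
  | smul c x _ hx => simp [inner_smul_right, hx]

theorem isPolar_of_mem_holIn {s : Multiset E} (hs : s ≠ 0) (hs0 : 0 ∉ s) {φ : holGerms E}
    (hφ : φ ∈ holIn (Submodule.span ℝ {x | x ∈ s})ᗮ) :
    IsPolar (algebraMap (holGerms E) (MeroGerm E) φ * invProd s) := by
  obtain ⟨k, ℓ, g, hg, hℓ, rfl⟩ := hφ
  induction s using Quot.inductionOn with | _ l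
  refine ⟨k, ℓ, g, hg, l.length, l.get, ?_, fun j h => hs0 ?_, fun i j => ?_, ?_⟩
  · exact List.length_pos_iff.2 fun h => hs (by rw [h]; rfl)
  · rw [← h]
    exact l.get_mem j
  · exact Submodule.inner_left_of_mem_orthogonal
      (Submodule.subset_span (l.get_mem j)) (hℓ i)
  · congr 1
    change (Multiset.map invForm (l : Multiset E)).prod = _
    rw [Multiset.map_coe, Multiset.prod_coe, ← List.prod_ofFn]
    congr 1
    conv_lhs => rw [← List.ofFn_get l, List.map_ofFn]
    rfl

theorem IsPolar.exists_mem_holIn {f : MeroGerm E} (hf : IsPolar f) :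
    ∃ s : Multiset E, s ≠ 0 ∧ 0 ∉ s ∧ ∃ φ ∈ holIn (Submodule.span ℝ {x | x ∈ s})ᗮ,
      f = algebraMap (holGerms E) (MeroGerm E) φ * invProd s := by
  obtain ⟨k, ℓ, h, hh, n, L, hn, hL, hℓ, rfl⟩ := hf
  refine ⟨Finset.univ.val.map L, fun h0 => ?_, fun h0 => ?_, _, ⟨k, ℓ, h, hh, fun i => ?_, rfl⟩, ?_⟩
  · have := congrArg Multiset.card h0
    simp at this
    omega
  · obtain ⟨j, -, hj⟩ := Multiset.mem_map.1 h0
    exact hL j hj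
  · refine mem_orthogonal_span fun x hx => ?_
    rw [Set.mem_ofPred_eq] at hx
    obtain ⟨j, -, rfl⟩ := Multiset.mem_map.1 hx
    exact hℓ i j
  · rw [invProd, Multiset.map_map]
    rfl

/-- Existence in `𝓜 = 𝓜₊ ⊕ 𝓜₋`: modulo polar germs, the number of poles can be lowered. -/
theorem exists_sub_mem_polarGerms (f : MeroGerm E) : ∃ p : holGerms E,
    f - algebraMap (holGerms E) (MeroGerm E) p ∈ polarGerms E := by
  classical
  obtain ⟨s, φ, hs0, rfl⟩ := exists_eq_mul_invProd f
  obtain ⟨n, hn⟩ : ∃ n, s.card = n := ⟨_, rfl⟩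
  induction n generalizing s φ with
  | zero =>
    obtain rfl := Multiset.card_eq_zero.1 hn
    exact ⟨φ, by simp [invProd, zero_mem]⟩
  | succ n ih =>
    have hs : s ≠ 0 := fun h => by simp [h] at hn
    obtain ⟨φ₀, hφ₀, q, rfl⟩ := exists_eq_add_sum_linForm_mul s.toFinset φ
    have hset : ((s.toFinset : Finset E) : Set E) = {x | x ∈ s} := by ext; simp
    rw [hset] at hφ₀
    have h := fun (x : E) (hx : x ∈ s.toFinset) =>
      ih (s.erase x) (q x) (fun h => hs0 (Multiset.mem_of_mem_erase h)) (by
        rw [Multiset.card_erase_of_mem (Multiset.mem_toFinset.1 hx), hn]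
        simp)
    choose! p hp using h
    refine ⟨∑ x ∈ s.toFinset, p x, ?_⟩
    have h1 : ∀ x ∈ s.toFinset, algebraMap (holGerms E) (MeroGerm E) (linForm x * q x) * invProd s =
        algebraMap (holGerms E) (MeroGerm E) (q x) * invProd (s.erase x) := by
      intro x hx
      have hxs := Multiset.mem_toFinset.1 hx
      have hx0 : x ≠ 0 := fun h => hs0 (h ▸ hxs)
      conv_lhs => rw [← Multiset.cons_erase hxs, invProd_cons, map_mul]
      linear_combination (algebraMap (holGerms E) (MeroGerm E) (q x) * invProd (s.erase x)) *
        algebraMap_linForm_mul_invForm hx0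
    rw [map_add, map_sum, map_sum, add_mul, Finset.sum_mul, Finset.sum_congr rfl h1, add_sub_assoc,
      ← Finset.sum_sub_distrib]
    exact add_mem (AddSubgroup.subset_closure (isPolar_of_mem_holIn hs hs0 hφ₀))
      (sum_mem hp)

/-- Cancellation in `(φ ∏ u) / ∏ (u + t)`. -/
theorem IsProjectionSystem.apply_prodForm_mul {n : ℕ} {Φ : Multiset E → holGerms E →+ holGerms E}
    (hΦ : IsProjectionSystem n Φ) (u t : Multiset E) (hn : (u + t).card ≤ n) (hu : 0 ∉ u)
    (ht : 0 ∉ t) (φ : holGerms E) : Φ (u + t) (prodForm u * φ) = Φ t φ := by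
  classical
  induction u using Multiset.induction_on with
  | empty => simp [prodForm]
  | cons L u ih =>
    have h0 : 0 ∉ L ::ₘ u + t := by
      rw [Multiset.mem_add, not_or]
      exact ⟨hu, ht⟩
    rw [prodForm_cons, mul_assoc, (hΦ.2 _ hn h0).1 L (by simp)]
    rw [Multiset.mem_cons, not_or] at hu
    rw [Multiset.cons_add] at hn ⊢
    have := ih (by simp at hn ⊢; omega) hu.2
    convert this using 2
    congr 1
    convert Multiset.erase_cons_head L (u + t)

/-- An element of `𝓜₋`, written over a common denominator, has a numerator that the projection
systems annihilate. -/
theorem exists_numerator_of_mem_polarGerms {f : MeroGerm E} (hf : f ∈ polarGerms E) :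
    ∃ (s : Multiset E) (x : holGerms E), 0 ∉ s ∧
      algebraMap (holGerms E) (MeroGerm E) x = f * algebraMap _ _ (prodForm s) ∧
      ∀ (r : Multiset E) (n : ℕ) (Φ : Multiset E → holGerms E →+ holGerms E), 0 ∉ r →
        IsProjectionSystem n Φ → (r + s).card ≤ n → Φ (r + s) (prodForm r * x) = 0 := by
  induction hf using AddSubgroup.closure_induction with
  | mem f hf =>
    obtain ⟨s, hs, hs0, φ, hφ, rfl⟩ := IsPolar.exists_mem_holIn hf
    refine ⟨s, φ, hs0, ?_, fun r n Φ hr hΦ hn => ?_⟩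
    · rw [mul_assoc, mul_comm (invProd s), algebraMap_prodForm_mul_invProd hs0, mul_one]
    · rw [hΦ.apply_prodForm_mul r s hn hr hs0]
      exact (hΦ.2 s ((Multiset.card_le_card (Multiset.le_add_left s r)).trans hn) hs0).2 hs φ hφ
  | zero => exact ⟨0, 0, by simp, by simp, by simp⟩
  | neg f _ ih =>
    obtain ⟨s, x, hs0, hx, h⟩ := ih
    refine ⟨s, -x, hs0, by rw [map_neg, hx]; ring, fun r n Φ hr hΦ hn => ?_⟩
    rw [mul_neg, map_neg, h r n Φ hr hΦ hn, neg_zero]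
  | add f f' _ _ ih ih' =>
    obtain ⟨s, x, hs0, hx, h⟩ := ih
    obtain ⟨s', x', hs0', hx', h'⟩ := ih'
    refine ⟨s + s', x * prodForm s' + x' * prodForm s, by simp [hs0, hs0'], ?_,
      fun r n Φ hr hΦ hn => ?_⟩
    · rw [map_add, map_mul, map_mul, hx, hx', prodForm_add, map_mul]
      ring
    · have e : r + s' + s = r + (s + s') := by abel
      have e' : r + s + s' = r + (s + s') := by abel
      have h1 := h (r + s') n Φ (by simp [hr, hs0']) hΦ (e ▸ hn)
      have h2 := h' (r + s) n Φ (by simp [hr, hs0]) hΦ (e' ▸ hn)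
      rw [e, prodForm_add] at h1
      rw [e', prodForm_add] at h2
      have h3 : prodForm r * (x * prodForm s' + x' * prodForm s) =
          prodForm r * prodForm s' * x + prodForm r * prodForm s * x' := by ring
      rw [h3, map_add, h1, h2, add_zero]

/-- Uniqueness in `𝓜 = 𝓜₊ ⊕ 𝓜₋`. -/
theorem eq_zero_of_algebraMap_mem_polarGerms {p : holGerms E}
    (hp : algebraMap (holGerms E) (MeroGerm E) p ∈ polarGerms E) : p = 0 := by
  obtain ⟨s, x, hs0, hx, h⟩ := exists_numerator_of_mem_polarGerms hp
  rw [← map_mul] at hx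
  obtain ⟨c, hc⟩ := IsLocalization.exists_of_eq (M := linForms E) hx
  obtain ⟨r, hr, hcr⟩ := exists_eq_prodForm c.2
  obtain ⟨Φ, hΦ⟩ := exists_isProjectionSystem (E := E) (r + s).card
  have h1 := h r _ Φ hr hΦ le_rfl
  have h2 := hΦ.apply_prodForm_mul (r + s) 0 (by simp) (by simp [hr, hs0]) (by simp) p
  rw [hcr] at hc
  rw [add_zero, prodForm_add, mul_assoc, mul_comm (prodForm s), ← hc, h1, hΦ.1] at h2
  exact h2.symm

theorem existsUnique_sub_mem_polarGerms (f : MeroGerm E) : ∃! p : holGerms E,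
    f - algebraMap (holGerms E) (MeroGerm E) p ∈ polarGerms E := by
  obtain ⟨p, hp⟩ := exists_sub_mem_polarGerms f
  refine ⟨p, hp, fun q hq => sub_eq_zero.1 (eq_zero_of_algebraMap_mem_polarGerms ?_)⟩
  have := sub_mem hp hq
  rw [map_sub]
  convert this using 1
  ring

/-! ### The projection onto the holomorphic germs -/

theorem piPlus_spec (f : MeroGerm E) :
    f - algebraMap (holGerms E) (MeroGerm E) (piPlus f) ∈ polarGerms E := by
  have h := exists_sub_mem_polarGerms f
  rw [piPlus, dif_pos h]
  exact h.choose_spec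

theorem piPlus_eq {f : MeroGerm E} {p : holGerms E}
    (h : f - algebraMap (holGerms E) (MeroGerm E) p ∈ polarGerms E) : piPlus f = p :=
  (existsUnique_sub_mem_polarGerms f).unique (piPlus_spec f) h

/-- Removal of one pole at a time, with new numerators that depend on the family `L` only through
the coefficients `a` of the orthogonal projections onto the span of the `L v`, `v ∈ V`. -/
theorem exists_piPlus_frac_eq_sum {W : Type*} [Fintype W] [DecidableEq W] {V : Finset W}
    (hV : V.Nonempty) {g : (W → ℂ) → ℂ} (hg : AnalyticAt ℂ g 0) (a : W → W → ℝ) :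
    ∃ (f : W → (W → ℂ) → ℂ) (hf : ∀ v, AnalyticAt ℂ (f v) 0),
      ∀ {E : Type*} [NormedAddCommGroup E] [InnerProductSpace ℝ E] (L : W → E),
        (∀ v ∈ V, L v ≠ 0) →
        (∀ w, ∀ u ∈ V, inner ℝ (L w - ∑ v ∈ V, a w v • L v) (L u) = 0) →
        piPlus (frac g hg L V) = ∑ v ∈ V, piPlus (frac (f v) (hf v) L (V.erase v)) := by
  obtain ⟨f, hf, h⟩ := exists_subst_eq_add_sum V hg a
  refine ⟨f, hf, fun {E} _ _ L hL ho => piPlus_eq ?_⟩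
  have h1 : ∀ v ∈ V, algebraMap (holGerms E) (MeroGerm E) (linForm (L v) * subst (f v) (hf v) L) *
      ∏ v ∈ V, invForm (L v) = frac (f v) (hf v) L (V.erase v) := by
    intro v hv
    rw [frac, ← Finset.mul_prod_erase V _ hv, map_mul]
    linear_combination (algebraMap (holGerms E) (MeroGerm E) (subst (f v) (hf v) L) *
      ∏ x ∈ V.erase v, invForm (L x)) * algebraMap_linForm_mul_invForm (hL v hv)
  rw [frac, h L, map_add, map_sum, map_sum, add_mul, Finset.sum_mul, Finset.sum_congr rfl h1,
    add_sub_assoc, ← Finset.sum_sub_distrib]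
  refine add_mem (AddSubgroup.subset_closure ?_) (sum_mem fun v _ => piPlus_spec _)
  -- the first summand is a polar germ
  have hp : (∏ v ∈ V, invForm (L v) : MeroGerm E) = invProd (V.val.map L) := by
    rw [invProd, Multiset.map_map]
    rfl
  rw [hp]
  refine isPolar_of_mem_holIn (fun h0 => ?_) (fun h0 => ?_)
    ⟨Fintype.card W, fun i => L ((Fintype.equivFin W).symm i) -
      ∑ v ∈ V, a ((Fintype.equivFin W).symm i) v • L v,
      fun y => g fun w => y (Fintype.equivFin W w), ?_, fun i => ?_, ?_⟩
  · exact hV.ne_empty (by simpa using h0)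
  · obtain ⟨v, hv, hv0⟩ := Multiset.mem_map.1 h0
    exact hL v hv hv0
  · exact AnalyticAt.fun_comp_of_eq (g := g) hg ((ContinuousLinearMap.pi fun w =>
      ContinuousLinearMap.proj (R := ℂ) (φ := fun _ : Fin (Fintype.card W) => ℂ)
        (Fintype.equivFin W w)).analyticAt 0) rfl
  · refine mem_orthogonal_span fun x hx => ?_
    rw [Set.mem_ofPred_eq] at hx
    obtain ⟨v, hv, rfl⟩ := Multiset.mem_map.1 hx
    exact ho _ v hv
  · exact subst_congr _ _ _ _ (.of_forall fun z => by simp)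

theorem exists_coeff_orthogonal {W : Type*} (V : Finset W) (L : W → E) :
    ∃ a : W → W → ℝ, ∀ w, ∀ u ∈ V, inner ℝ (L w - ∑ v ∈ V, a w v • L v) (L u) = 0 := by
  classical
  let F := Submodule.span ℝ ((V.image L : Finset E) : Set E)
  have hF : ∀ w, ∃ c : W → ℝ, ∑ v ∈ V, c v • L v = F.starProjection (L w) := fun w => by
    have hF : F = Submodule.span ℝ (L '' (V : Set W)) := by simp [F]
    exact (Submodule.mem_span_image_finset_iff_exists_fun' _).1
      (hF.le (F.starProjection_apply_mem (L w)))
  choose a ha using hF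
  refine ⟨a, fun w u hu => ?_⟩
  rw [ha]
  exact F.inner_left_of_mem_orthogonal
    (Submodule.subset_span (by simpa using ⟨u, hu, rfl⟩)) (F.sub_starProjection_mem_orthogonal _)

theorem ev₀_add (φ ψ : holGerms E) : ev₀ (φ + ψ) = ev₀ φ + ev₀ ψ := by
  obtain ⟨φ, hφ⟩ := φ
  obtain ⟨ψ, hψ⟩ := ψ
  induction φ using Germ.inductionOn
  induction ψ using Germ.inductionOn
  rfl

theorem ev₀_sum {J : Type*} (V : Finset J) (φ : J → holGerms E) :
    ev₀ (∑ v ∈ V, φ v) = ∑ v ∈ V, ev₀ (φ v) :=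
  map_sum (AddMonoidHom.mk' ev₀ ev₀_add) φ V

theorem piPlus_frac_empty {W : Type*} [Fintype W] {g : (W → ℂ) → ℂ} (hg : AnalyticAt ℂ g 0)
    (L : W → E) : piPlus (frac g hg L ∅) = subst g hg L :=
  piPlus_eq (by simp [frac, zero_mem])

/-- By induction on the number of poles: the Gram matrices of the two families are proportional,
so that the same coefficients of orthogonal projections serve for both. -/
theorem ev₀_piPlus_frac_eq {W : Type*} [Fintype W] [DecidableEq W] (V : Finset W)
    {g : (W → ℂ) → ℂ} (hg : AnalyticAt ℂ g 0) {L₁ L₂ : W → E} {c : ℝ} (h₁ : ∀ v, L₁ v ≠ 0)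
    (h₂ : ∀ v, L₂ v ≠ 0) (hc : ∀ v w, inner ℝ (L₁ v) (L₁ w) = c * inner ℝ (L₂ v) (L₂ w)) :
    ev₀ (piPlus (frac g hg L₁ V)) = ev₀ (piPlus (frac g hg L₂ V)) := by
  induction V using Finset.strongInduction generalizing g with
  | H V ih =>
    rcases V.eq_empty_or_nonempty with rfl | hV
    · rw [piPlus_frac_empty, piPlus_frac_empty]
      rfl
    obtain ⟨a, ha⟩ := exists_coeff_orthogonal V L₁
    obtain ⟨f, hf, h⟩ := exists_piPlus_frac_eq_sum hV hg a
    have hc0 : c ≠ 0 := by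
      rintro rfl
      obtain ⟨v, -⟩ := hV
      have := hc v v
      rw [zero_mul, inner_self_eq_zero] at this
      exact h₁ v this
    have ha₂ : ∀ w, ∀ u ∈ V, inner ℝ (L₂ w - ∑ v ∈ V, a w v • L₂ v) (L₂ u) = 0 := by
      intro w u hu
      have := ha w u hu
      simp only [inner_sub_left, sum_inner, real_inner_smul_left, hc] at this ⊢
      refine (mul_eq_zero.1 (Eq.trans ?_ this)).resolve_left hc0
      rw [mul_sub, Finset.mul_sum]
      congr 1
      exact Finset.sum_congr rfl fun v _ => by ring
    rw [h L₁ (fun v _ => h₁ v) ha, h L₂ (fun v _ => h₂ v) ha₂, ev₀_sum, ev₀_sum]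
    exact Finset.sum_congr rfl fun v hv => ih _ (Finset.erase_ssubset hv) (hf v)

end inner
end
end LinearPoles

theorem theorem5p1 {E : Type*} [NormedAddCommGroup E] [InnerProductSpace ℝ E]
    {W : Type*} [Fintype W] [DecidableEq W] (V : Finset W)
    (g : (W → ℂ) → ℂ) (hg : AnalyticAt ℂ g 0) :
    -- the decomposition on which `π₊` rests
    (∀ f : LinearPoles.MeroGerm E, ∃! p : LinearPoles.holGerms E,
      f - algebraMap (LinearPoles.holGerms E) (LinearPoles.MeroGerm E) p ∈
        LinearPoles.polarGerms E) ∧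
    -- (i)
    (∀ L : W → E, LinearIndependent ℝ L → V.Nonempty →
      ∃ (f : W → (W → ℂ) → ℂ) (hf : ∀ v, AnalyticAt ℂ (f v) 0),
        LinearPoles.piPlus (LinearPoles.frac g hg L V) =
          ∑ v ∈ V, LinearPoles.piPlus (LinearPoles.frac (f v) (hf v) L (V.erase v))) ∧
    -- (ii)
    (∀ (L₁ L₂ : W → E) (c : ℝ), LinearIndependent ℝ L₁ → LinearIndependent ℝ L₂ →
      (∀ v w, inner ℝ (L₁ v) (L₁ w) = c * inner ℝ (L₂ v) (L₂ w)) →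
        LinearPoles.ev₀ (LinearPoles.piPlus (LinearPoles.frac g hg L₁ V)) =
          LinearPoles.ev₀ (LinearPoles.piPlus (LinearPoles.frac g hg L₂ V))) := by
  refine ⟨LinearPoles.existsUnique_sub_mem_polarGerms, fun L hL hV => ?_,
    fun L₁ L₂ c h₁ h₂ hc => LinearPoles.ev₀_piPlus_frac_eq V hg h₁.ne_zero h₂.ne_zero hc⟩
  obtain ⟨a, ha⟩ := LinearPoles.exists_coeff_orthogonal V L
  obtain ⟨f, hf, h⟩ := LinearPoles.exists_piPlus_frac_eq_sum hV hg a
  exact ⟨f, hf, h L (fun v _ => hL.ne_zero v) ha⟩
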